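/- For $m,n\in\mathbb N$ let $\mathrm{RSK}$ be the Robinson–Schensted–Knuth correspondence from $m\times n$ matrices $\alpha$ over $\mathbb N$ to pairs $(P,Q)$ of semistandard Young tableaux of the same shape: the biletters $(i|j)$, each repeated $\alpha_{ij}$ times, are read down the columns of $\alpha$ from left to right, the letters $i$ are row-inserted to form $P$, and the letters $j$ are recorded in $Q$. For such a pair let $[P|Q]\in\mathbb C[z_{ij}]_{1\le i\le m,\,1\le j\le n}$ be the product, over the columns $c$ of the shape, of the minors of the generic matrix $(z_{ij})$ whose row indices are the entries of the $c$-th column of $P$ and whose column indices are the entries of the $c$-th column of $Q$. Let $\mathsf{RSK}$ be the linear operator on $\mathbb C[z_{ij}]$ with $\mathsf{RSK}(z^\alpha)=[P|Q]$, where $(P,Q)=\mathrm{RSK}(\alpha)$. Let $\mathsf{RSK}_{m,n,d}$ be the matrix, in the monomial basis, of its restriction to the homogeneous polynomials of degree $d$, and let $\mathsf{RSK}_{\sigma,\pi}$ be the matrix of its restriction to the span of the monomials $z^\alpha$ such that $\alpha$ has row sums $\sigma$ and column sums $\pi$. **Theorem.** Let $m,n\ge 3$ and $d\ge 4$. Then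 the characteristic polynomial of $\mathsf{RSK}_{m,n,d}$, which has integer coefficients, is not solvable by radicals over $\mathbb Q$: it has a complex root that cannot be obtained from rational numbers by field operations and extraction of $k$-th roots ($k\ge1$). Moreover, after a reordering of the monomial basis, $\mathsf{RSK}_{m,n,d}$ is block diagonal with $\mathsf{RSK}_{(2,1,1),(1,2,1)}$ as a diagonal block; the characteristic polynomial of this block is $(t-1)(t+1)f(t)$ with $f(t)=t^5+t^4-3t^3-2t^2-t-1$; and $f$ is irreducible over $\mathbb Q$, has exactly three real roots, and has Galois group over $\mathbb Q$ isomorphic to $S_5$. -/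

import Mathlib

open Polynomial

namespace RSK

/-! ### The combinatorial correspondence

A tableau is stored as the list of its rows (top to bottom), a row as the list of its labels
(left to right).  The labels `1, …, m` are the elements of `Fin m`, in the same order. -/

/-- Insert `p` into a weakly increasing row: the leftmost label larger than `p` is replaced by `p`
and returned as the bumped label; if there is none, `p` is adjoined at the end of the row. -/
def rowInsert {α : Type*} [LinearOrder α] : List α → α → List α × Option α
  | [], p => ([p], none)
  | a :: r, p =>
    if p < a then (p :: r, some a)
    else (a :: (rowInsert r p).1, (rowInsert r p).2)

/-- Row insertion `P ← p`, returning the new tableau and the (zero-based) index of the row at whose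
end the new box was created. -/
def tableauInsert {α : Type*} [LinearOrder α] : List (List α) → α → List (List α) × ℕ
  | [], p => ([[p]], 0)
  | r :: P, p =>
    match rowInsert r p with
    | (r', none) => (r' :: P, 0)
    | (r', some b) => (r' :: (tableauInsert P b).1, (tableauInsert P b).2 + 1)

/-- Place a box labelled `q` at the end of the row with index `i` (a new row if `i` is the number
of rows). -/
def addBox {α : Type*} : List (List α) → ℕ → α → List (List α)
  | [], _, q => [[q]]
  | r :: Q, 0, q => (r ++ [q]) :: Q
  | r :: Q, i + 1, q => r :: addBox Q i q

/-- Insertion `(P, Q) ← (p|q)` of a biletter into a pair of tableaux of the same shape. -/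
def biletterInsert {α β : Type*} [LinearOrder α]
    (PQ : List (List α) × List (List β)) (b : α × β) : List (List α) × List (List β) :=
  ((tableauInsert PQ.1 b.1).1, addBox PQ.2 (tableauInsert PQ.1 b.1).2 b.2)

/-- The biword of an `m × n` matrix of natural numbers: read the entries down the columns, from the
left column to the right one, recording `(i|j)` as many times as the entry `(i, j)` says. -/
def biword {m n : ℕ} (a : Fin m × Fin n →₀ ℕ) : List (Fin m × Fin n) :=
  (List.finRange n).flatMap fun j =>
    (List.finRange m).flatMap fun i => List.replicate (a (i, j)) (i, j)

/-- The Robinson–Schensted–Knuth correspondence `α ↦ (P, Q)`. -/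
def rsk {m n : ℕ} (a : Fin m × Fin n →₀ ℕ) : List (List (Fin m)) × List (List (Fin n)) :=
  (biword a).foldl biletterInsert ([], [])

/-! ### Bitableaux -/

/-- The labels, from top to bottom, in the column of `T` with (zero-based) index `c`. -/
def column {α : Type*} (T : List (List α)) (c : ℕ) : List α :=
  T.filterMap fun r => r[c]?

/-- The minor of the generic matrix `Z = [z_{ij}]` whose successive row and column indices are the
first and the second components of the list `l`. -/
noncomputable def minor {m n : ℕ} (l : List (Fin m × Fin n)) :
    MvPolynomial (Fin m × Fin n) ℂ :=
  Matrix.det (Matrix.of fun (a b : Fin l.length) => MvPolynomial.X ((l.get a).1, (l.get b).2))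

/-- The bitableau `[P|Q]`: the product over the columns `c` of the minors of `Z` whose row indices
are the `c`-th column of `P` and whose column indices are the `c`-th column of `Q`. -/
noncomputable def bitableau {m n : ℕ} (P : List (List (Fin m))) (Q : List (List (Fin n))) :
    MvPolynomial (Fin m × Fin n) ℂ :=
  ((List.range (P.headD []).length).map fun c => minor ((column P c).zip (column Q c))).prod

/-! ### The linear operator -/

/-- The linear operator on `ℂ[z_{ij}]` sending each monomial `z^α` to the bitableau `[P|Q]`, where
`(P, Q)` is the pair of tableaux corresponding to `α`. -/
noncomputable def operator (m n : ℕ) :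
    MvPolynomial (Fin m × Fin n) ℂ →ₗ[ℂ] MvPolynomial (Fin m × Fin n) ℂ :=
  (MvPolynomial.basisMonomials (Fin m × Fin n) ℂ).constr ℂ
    fun a => bitableau (rsk a).1 (rsk a).2

/-- The matrix of `operator m n` on the monomials with exponents in `S`: the entry `(β, α)` is the
coefficient of `z^β` in the image of `z^α`. -/
noncomputable def matrixOn {m n : ℕ} (S : Finset (Fin m × Fin n →₀ ℕ)) : Matrix S S ℂ :=
  Matrix.of fun β α =>
    MvPolynomial.coeff β.1 (operator m n (MvPolynomial.monomial α.1 1))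

/-- The exponent matrices of the monomials of degree `d` in the variables `z_{ij}`. -/
noncomputable def exponents (m n d : ℕ) : Finset (Fin m × Fin n →₀ ℕ) :=
  Finset.finsuppAntidiag Finset.univ d

/-- The contingency tables with row margins `σ` and column margins `π`. -/
noncomputable def contingencyTables {m n : ℕ} (σ : Fin m → ℕ) (π : Fin n → ℕ) :
    Finset (Fin m × Fin n →₀ ℕ) :=
  (exponents m n (∑ i, σ i)).filter fun a =>
    (∀ i, ∑ j, a (i, j) = σ i) ∧ ∀ j, ∑ i, a (i, j) = π j

/-- The matrix of the restriction of the operator to the space of polynomials that are homogeneous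
of degree `d` (the operator preserves the degree). -/
noncomputable def degreeMatrix (m n d : ℕ) : Matrix (exponents m n d) (exponents m n d) ℂ :=
  matrixOn (exponents m n d)

/-- The matrix of the restriction of the operator to the weight space of `(σ, π)` (the operator
preserves the weight). -/
noncomputable def weightMatrix {m n : ℕ} (σ : Fin m → ℕ) (π : Fin n → ℕ) :
    Matrix (contingencyTables σ π) (contingencyTables σ π) ℂ :=
  matrixOn (contingencyTables σ π)

/-! ### Solvability by radicals -/

/-- A rational polynomial is solvable by radicals if each of its complex roots is obtained from
rational numbers by field operations and the extraction of `n`-th roots. -/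
def SolvableByRadicals (p : ℚ[X]) : Prop :=
  ∀ x ∈ p.rootSet ℂ, x ∈ solvableByRad ℚ ℂ

/-- The quintic `t⁵ + t⁴ - 3t³ - 2t² - t - 1`. -/
noncomputable def quintic : ℚ[X] :=
  X ^ 5 + X ^ 4 - 3 * X ^ 3 - 2 * X ^ 2 - X - 1

end RSK

/-! Row insertion only moves letters. So the content of `P` is the multiset of the `i`, and that of
`Q` the multiset of the `j`, in the biword of `α`. Each Leibniz term of a minor uses every row index
and every column index once. Hence `[P|Q]` has the same row and column sums as `z^α`, the operator
preserves weights, and its matrix in degree `d` is block diagonal (`coeff_operator_eq_zero`).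

For `d = k + 4` consider the weight with row sums `(k+2,1,1,0,…)` and column sums `(1,k+2,1,0,…)`.
It has exactly seven tables (`exists_table_eq`). In each of the seven tableau pairs, raising `k` by
one adds a one-box column contributing the factor `z₁₂`, so the images are `z₁₂ ^ k` times
polynomials independent of `k` (`rsk_padTable_table`). The block is therefore the same integer
matrix `blockMatrix` for all `m, n ≥ 3` and `d ≥ 4`, namely that of `(2,1,1), (1,2,1)`.

This matrix is similar over `ℤ` to a companion matrix, from which its characteristic polynomial
`(t-1)(t+1)f` is read off. The quintic `f` is irreducible modulo 2 and has three real roots, so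
complex conjugation acts as a transposition on its five roots. A transitive group of prime degree
containing a transposition is the full symmetric group, and `S₅` is not solvable. Thus no root of
`f` is expressible by radicals, and each one is an eigenvalue of the degree `d` matrix. -/

namespace RSK

/-! ### Row insertion: content, shape and column strictness. -/

section Insertion

variable {α β : Type*} [LinearOrder α]

/-- The row `r` may stand immediately above the row `s` in a column-strict tableau: `s` is not
longer than `r`, and its entries are larger than those of `r` in the same column. -/
inductive Dominates : List α → List α → Prop
  | nil (r : List α) : Dominates r []
  | cons {a b : α} {r s : List α} : a < b → Dominates r s → Dominates (a :: r) (b :: s)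

theorem Dominates.length_le {r s : List α} (h : Dominates r s) : s.length ≤ r.length := by
  induction h with
  | nil => simp
  | cons _ _ ih => simpa using ih

theorem rowInsert_perm (r : List α) (p : α) :
    ((rowInsert r p).1 ++ (rowInsert r p).2.toList).Perm (p :: r) := by
  induction r with
  | nil => simp [rowInsert]
  | cons a r ih =>
    rw [rowInsert]
    split_ifs with h
    · simp only [Option.toList_some, List.cons_append, List.perm_cons]
      exact List.perm_append_singleton a r
    · simp only [List.cons_append]
      exact (ih.cons a).trans (List.Perm.swap p a r)

theorem lt_of_rowInsert_eq_some {r : List α} {p b : α} (h : (rowInsert r p).2 = some b) :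
    p < b := by
  induction r with
  | nil => simp [rowInsert] at h
  | cons a r ih =>
    rw [rowInsert] at h
    split_ifs at h with hp
    · simp only [Option.some.injEq] at h
      exact h ▸ hp
    · exact ih h

theorem Dominates.rowInsert_left {r s : List α} (h : Dominates r s) (p : α) :
    Dominates (rowInsert r p).1 s := by
  induction h with
  | nil => exact .nil _
  | cons hab hrs ih =>
    rw [rowInsert]
    split_ifs with hp
    · exact .cons (hp.trans hab) hrs
    · exact .cons hab ih

/-- The entry below the bumped `b` exceeds `b`, so `b` lands weakly to the left of the column it
left. There it stands below `p` itself, or below an entry that is at most `p < b`. -/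
theorem Dominates.rowInsert_bumped {r s : List α} (h : Dominates r s) {p b : α}
    (hb : (rowInsert r p).2 = some b) :
    Dominates (rowInsert r p).1 (rowInsert s b).1 := by
  induction r generalizing s with
  | nil => simp [rowInsert] at hb
  | cons a r ih =>
    rw [rowInsert] at hb ⊢
    by_cases hp : p < a
    · simp only [hp, if_true, Option.some.injEq] at hb ⊢
      subst hb
      cases h with
      | nil => exact .cons hp (.nil _)
      | cons hac hrs =>
        rw [rowInsert, if_pos hac]
        exact .cons hp hrs
    · simp only [hp, if_false] at hb ⊢
      have hpb := lt_of_rowInsert_eq_some hb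
      cases h with
      | nil => exact .cons ((not_lt.mp hp).trans_lt hpb) (.nil _)
      | @cons _ c _ s hac hrs =>
        rw [rowInsert]
        split_ifs with hbc
        · exact .cons ((not_lt.mp hp).trans_lt hpb) (hrs.rowInsert_left p)
        · exact .cons hac (ih hrs hb)

theorem tableauInsert_cons (r : List α) (P : List (List α)) (p : α) :
    tableauInsert (r :: P) p =
      match (rowInsert r p).2 with
      | none => ((rowInsert r p).1 :: P, 0)
      | some b => ((rowInsert r p).1 :: (tableauInsert P b).1, (tableauInsert P b).2 + 1) := by
  rw [tableauInsert]
  rcases rowInsert r p with ⟨r', _ | b⟩ <;> rfl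

theorem tableauInsert_flatten_perm (P : List (List α)) (p : α) :
    (tableauInsert P p).1.flatten.Perm (p :: P.flatten) := by
  induction P generalizing p with
  | nil => simp [tableauInsert]
  | cons r P ih =>
    have h := rowInsert_perm r p
    rw [tableauInsert_cons]
    rcases hb : (rowInsert r p).2 with _ | b
    · simp only [hb, Option.toList_none, List.append_nil, List.flatten_cons] at h ⊢
      exact h.append_right _
    · simp only [hb, Option.toList_some, List.flatten_cons] at h ⊢
      refine ((ih b).append_left _).trans ?_
      simpa using h.append_right P.flatten

theorem addBox_flatten_perm (Q : List (List β)) (i : ℕ) (q : β) :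
    (addBox Q i q).flatten.Perm (q :: Q.flatten) := by
  induction Q generalizing i with
  | nil => simp [addBox]
  | cons r Q ih =>
    cases i with
    | zero =>
      simp only [addBox, List.flatten_cons, List.append_assoc, List.singleton_append]
      exact List.perm_middle
    | succ i =>
      simp only [addBox, List.flatten_cons]
      exact ((ih i).append_left r).trans List.perm_middle

theorem tableauInsert_map_length {P : List (List α)} {Q : List (List β)}
    (h : P.map List.length = Q.map List.length) (p : α) (q : β) :
    (tableauInsert P p).1.map List.length =
      (addBox Q (tableauInsert P p).2 q).map List.length := by
  induction P generalizing Q p with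
  | nil =>
    obtain rfl : Q = [] := by simpa using h.symm
    simp [tableauInsert, addBox]
  | cons r P ih =>
    obtain _ | ⟨s, Q⟩ := Q
    · simp at h
    simp only [List.map_cons, List.cons.injEq] at h
    have hl := (rowInsert_perm r p).length_eq
    rw [tableauInsert_cons]
    rcases hb : (rowInsert r p).2 with _ | b
    · simp only [hb, Option.toList_none, List.append_nil, List.length_cons] at hl
      simp [addBox, hl, h]
    · simp only [hb, Option.toList_some, List.length_append, List.length_cons, List.length_nil] at hl
      simp only [List.map_cons, addBox, ih h.2 b, List.cons.injEq, and_true]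
      omega

theorem isChain_tableauInsert {P : List (List α)} (h : P.IsChain Dominates) (p : α) :
    (tableauInsert P p).1.IsChain Dominates := by
  induction P generalizing p with
  | nil => simp [tableauInsert]
  | cons r P ih =>
    rw [tableauInsert_cons]
    obtain _ | ⟨s, P⟩ := P
    · rcases hb : (rowInsert r p).2 with _ | b
      · simp
      · simpa [tableauInsert, rowInsert] using (Dominates.nil r).rowInsert_bumped hb
    · rw [List.isChain_cons_cons] at h
      rcases hb : (rowInsert r p).2 with _ | b
      · exact List.isChain_cons_cons.mpr ⟨h.1.rowInsert_left p, h.2⟩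
      · have hP := ih h.2 b
        have hd := h.1.rowInsert_bumped hb
        rw [tableauInsert_cons] at hP
        dsimp only
        rw [tableauInsert_cons]
        rcases hc : (rowInsert s b).2 with _ | c <;> rw [hc] at hP
        · exact List.isChain_cons_cons.mpr ⟨hd, hP⟩
        · exact List.isChain_cons_cons.mpr ⟨hd, hP⟩

/-- Column strictness is the invariant that makes the first row the longest, so that the product
over columns in `bitableau` omits no box. -/
theorem length_le_of_isChain {P : List (List α)} (h : P.IsChain Dominates) {r : List α}
    (hr : r ∈ P) : r.length ≤ (P.headD []).length := by
  induction P with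
  | nil => simp at hr
  | cons s P ih =>
    obtain rfl | hr := List.mem_cons.mp hr
    · simp
    obtain _ | ⟨t, P⟩ := P
    · simp at hr
    rw [List.isChain_cons_cons] at h
    exact (ih h.2 hr).trans h.1.length_le

/-- The properties of the pair of tableaux of a biword. -/
theorem foldl_biletterInsert_spec (l : List (α × β)) :
    let PQ := l.foldl biletterInsert ([], [])
    PQ.1.IsChain Dominates ∧ PQ.1.map List.length = PQ.2.map List.length ∧
      PQ.1.flatten.Perm (l.map Prod.fst) ∧ PQ.2.flatten.Perm (l.map Prod.snd) := by
  induction l using List.reverseRecOn with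
  | nil => simp
  | append_singleton l b ih =>
    obtain ⟨h1, h2, h3, h4⟩ := ih
    simp only [List.foldl_append, List.foldl_cons, List.foldl_nil, biletterInsert, List.map_append,
      List.map_cons, List.map_nil]
    refine ⟨isChain_tableauInsert h1 _, tableauInsert_map_length h2 _ _, ?_, ?_⟩
    · exact (tableauInsert_flatten_perm _ _).trans
        ((h3.cons _).trans (List.perm_append_singleton _ _).symm)
    · exact (addBox_flatten_perm _ _ _).trans
        ((h4.cons _).trans (List.perm_append_singleton _ _).symm)

end Insertion

/-! ### Reading tableaux by columns instead of rows. -/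

section Columns

variable {α β : Type*}

theorem column_cons (r : List α) (T : List (List α)) (c : ℕ) :
    column (r :: T) c = r[c]?.toList ++ column T c := by
  rw [column, List.filterMap_cons]
  cases h : r[c]? <;> simp [column]

theorem flatMap_range_getElem?_toList (r : List α) {L : ℕ} (h : r.length ≤ L) :
    (List.range L).flatMap (fun c => r[c]?.toList) = r := by
  induction r generalizing L with
  | nil => simp
  | cons a r ih =>
    obtain _ | L := L
    · simp at h
    simp only [List.range_succ_eq_map, List.flatMap_cons, List.getElem?_cons_zero,
      Option.toList_some, List.flatMap_map, List.getElem?_cons_succ]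
    rw [ih (by simpa using h)]
    rfl

theorem flatMap_column_perm {T : List (List α)} {L : ℕ} (h : ∀ r ∈ T, r.length ≤ L) :
    ((List.range L).flatMap (column T)).Perm T.flatten := by
  induction T with
  | nil => simp [column, List.flatMap_def]
  | cons r T ih =>
    have hc : column (r :: T) = fun c => r[c]?.toList ++ column T c :=
      funext (column_cons r T)
    rw [hc, List.flatten_cons]
    refine (List.flatMap_append_perm _ _ _).symm.trans ?_
    rw [flatMap_range_getElem?_toList r (h r (by simp))]
    exact (ih fun s hs => h s (by simp [hs])).append_left r

/-- Tableaux of equal shape merge into one tableau of pairs, so that facts about columns are needed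
for a single tableau only. -/
theorem zip_column {P : List (List α)} {Q : List (List β)}
    (h : P.map List.length = Q.map List.length) (c : ℕ) :
    (column P c).zip (column Q c) = column (List.zipWith List.zip P Q) c := by
  induction P generalizing Q with
  | nil => simp [column]
  | cons r P ih =>
    obtain _ | ⟨s, Q⟩ := Q
    · simp at h
    simp only [List.map_cons, List.cons.injEq] at h
    rw [List.zipWith_cons_cons, column_cons, column_cons, column_cons, ← ih h.2]
    by_cases hc : c < r.length
    · simp [List.getElem?_eq_getElem hc, List.getElem?_eq_getElem (h.1 ▸ hc),
        List.getElem?_zipWith, List.zip]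
    · have hs : ¬ c < s.length := h.1 ▸ hc
      simp [List.getElem?_eq_none (not_lt.mp hc), List.getElem?_eq_none (not_lt.mp hs),
        List.zip, List.getElem?_zipWith]

theorem flatten_zipWith_zip {P : List (List α)} {Q : List (List β)}
    (h : P.map List.length = Q.map List.length) :
    (List.zipWith List.zip P Q).flatten.map Prod.fst = P.flatten ∧
      (List.zipWith List.zip P Q).flatten.map Prod.snd = Q.flatten := by
  induction P generalizing Q with
  | nil =>
    obtain rfl : Q = [] := by simpa using h.symm
    simp
  | cons r P ih =>
    obtain _ | ⟨s, Q⟩ := Q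
    · simp at h
    simp only [List.map_cons, List.cons.injEq] at h
    simp only [List.zipWith_cons_cons, List.flatten_cons, List.map_append, ih h.2,
      List.map_fst_zip h.1.le, List.map_snd_zip h.1.ge, and_self]

end Columns

/-! ### The operator preserves row and column contents. -/

section Weight

variable {m n : ℕ}

/-- The weight of the variable `z_{ij}`: its row content and its column content. -/
def biweight (x : Fin m × Fin n) : (Fin m → ℕ) × (Fin n → ℕ) :=
  (Pi.single x.1 1, Pi.single x.2 1)

theorem sum_map_biweight (l : List (Fin m × Fin n)) :
    (l.map biweight).sum = (((l.map Prod.fst).map fun i => Pi.single i 1).sum,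
      ((l.map Prod.snd).map fun j => Pi.single j 1).sum) := by
  induction l with
  | nil => rfl
  | cons x l ih =>
    simp only [List.map_cons, List.sum_cons, ih]
    rfl

/-- A Leibniz term only permutes the row indices against the column indices, which changes neither
content. -/
theorem isWeightedHomogeneous_minor (l : List (Fin m × Fin n)) :
    (minor l).IsWeightedHomogeneous biweight (l.map biweight).sum := by
  rw [minor, Matrix.det_apply']
  refine MvPolynomial.IsWeightedHomogeneous.sum _ _ _ fun s _ => ?_
  have hprod : (∏ a, Matrix.of (fun (a b : Fin l.length) =>
      (MvPolynomial.X ((l.get a).1, (l.get b).2) : MvPolynomial (Fin m × Fin n) ℂ)) (s a) a)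
      |>.IsWeightedHomogeneous biweight
        (∑ a, biweight ((l.get (s a)).1, (l.get a).2)) :=
    MvPolynomial.IsWeightedHomogeneous.prod _ _ _ fun a _ =>
      MvPolynomial.isWeightedHomogeneous_X ℂ _ _
  have hw : ∑ a, biweight ((l.get (s a)).1, (l.get a).2) = (l.map biweight).sum := by
    rw [← Fin.sum_univ_fun_getElem]
    refine Prod.ext ?_ ?_
    · simp only [Prod.fst_sum, biweight]
      exact Equiv.sum_comp s fun a => (Pi.single (l.get a).1 1 : Fin m → ℕ)
    · simp only [Prod.snd_sum, biweight]
      rfl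
  rw [← hw, show ((Equiv.Perm.sign s : ℤ) : MvPolynomial (Fin m × Fin n) ℂ) =
    MvPolynomial.C ((Equiv.Perm.sign s : ℤ) : ℂ) by simp]
  simpa only [zero_add] using (MvPolynomial.isWeightedHomogeneous_C biweight _).mul hprod

theorem isWeightedHomogeneous_list_prod {ι : Type*} (l : List ι)
    (f : ι → MvPolynomial (Fin m × Fin n) ℂ) (d : ι → (Fin m → ℕ) × (Fin n → ℕ))
    (h : ∀ i ∈ l, (f i).IsWeightedHomogeneous biweight (d i)) :
    (l.map f).prod.IsWeightedHomogeneous biweight (l.map d).sum := by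
  induction l with
  | nil => exact MvPolynomial.isWeightedHomogeneous_one _ _
  | cons i l ih =>
    simp only [List.map_cons, List.prod_cons, List.sum_cons]
    exact (h i (by simp)).mul (ih fun j hj => h j (by simp [hj]))

theorem isWeightedHomogeneous_bitableau {P : List (List (Fin m))} {Q : List (List (Fin n))}
    (hP : P.IsChain Dominates) (hPQ : P.map List.length = Q.map List.length) :
    (bitableau P Q).IsWeightedHomogeneous biweight
      ((P.flatten.map fun i => Pi.single i 1).sum, (Q.flatten.map fun j => Pi.single j 1).sum) := by
  have hT : ∀ r ∈ List.zipWith List.zip P Q, r.length ≤ (P.headD []).length := by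
    intro r hr
    obtain ⟨a, b, hab, rfl⟩ : ∃ a b, (a, b) ∈ P.zip Q ∧ r = a.zip b := by
      rw [← List.map_uncurry_zip_eq_zipWith, List.mem_map] at hr
      obtain ⟨⟨a, b⟩, hab, rfl⟩ := hr
      exact ⟨a, b, hab, rfl⟩
    have := length_le_of_isChain hP (List.of_mem_zip hab).1
    simp only [List.length_zip]
    omega
  -- The weight is a sum over boxes, taken by columns on the left and by rows on the right.
  have hsum : (((List.range (P.headD []).length).map fun c =>
      (((column P c).zip (column Q c)).map biweight).sum).sum) =
      ((P.flatten.map fun i => Pi.single i 1).sum, (Q.flatten.map fun j => Pi.single j 1).sum) := by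
    rw [← (flatten_zipWith_zip hPQ).1, ← (flatten_zipWith_zip hPQ).2, ← sum_map_biweight,
      ← ((flatMap_column_perm hT).map biweight).sum_eq, List.map_flatMap]
    simp only [zip_column hPQ]
    rw [List.flatMap_def, List.sum_flatten, List.map_map]
    rfl
  rw [← hsum]
  exact isWeightedHomogeneous_list_prod _ _ _ fun c _ => isWeightedHomogeneous_minor _

theorem sum_map_biweight_biword (a : Fin m × Fin n →₀ ℕ) :
    ((biword a).map biweight).sum = Finsupp.weight biweight a := by
  rw [Finsupp.weight_apply, Finsupp.sum_fintype _ _ (by simp), Fintype.sum_prod_type_right]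
  simp only [biword, List.flatMap_def, List.map_flatten, List.map_replicate, List.sum_flatten,
    List.map_map, Function.comp_def, List.sum_replicate, Fin.sum_univ_def]

theorem isWeightedHomogeneous_bitableau_rsk (a : Fin m × Fin n →₀ ℕ) :
    (bitableau (rsk a).1 (rsk a).2).IsWeightedHomogeneous biweight
      (Finsupp.weight biweight a) := by
  obtain ⟨h1, h2, h3, h4⟩ := foldl_biletterInsert_spec (biword a)
  have := isWeightedHomogeneous_bitableau h1 h2
  rwa [(h3.map _).sum_eq, (h4.map _).sum_eq, ← sum_map_biweight, sum_map_biweight_biword] at this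

theorem operator_monomial (a : Fin m × Fin n →₀ ℕ) :
    operator m n (MvPolynomial.monomial a 1) = bitableau (rsk a).1 (rsk a).2 := by
  have h := (MvPolynomial.basisMonomials (Fin m × Fin n) ℂ).constr_basis ℂ
    (fun a => bitableau (rsk a).1 (rsk a).2) a
  rwa [MvPolynomial.coe_basisMonomials] at h

/-- The operator preserves row and column contents. -/
theorem coeff_operator_eq_zero {a b : Fin m × Fin n →₀ ℕ}
    (h : Finsupp.weight biweight b ≠ Finsupp.weight biweight a) :
    MvPolynomial.coeff b (operator m n (MvPolynomial.monomial a 1)) = 0 := by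
  rw [operator_monomial]
  exact (isWeightedHomogeneous_bitableau_rsk a).coeff_eq_zero b h

theorem weight_biweight_fst (a : Fin m × Fin n →₀ ℕ) (i : Fin m) :
    (Finsupp.weight biweight a).1 i = ∑ j, a (i, j) := by
  rw [Finsupp.weight_apply, Finsupp.sum_fintype _ _ (by simp), Fintype.sum_prod_type]
  simp [biweight, Prod.fst_sum, Finset.sum_apply, Pi.single_apply, Finset.sum_ite_eq]

theorem weight_biweight_snd (a : Fin m × Fin n →₀ ℕ) (j : Fin n) :
    (Finsupp.weight biweight a).2 j = ∑ i, a (i, j) := by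
  rw [Finsupp.weight_apply, Finsupp.sum_fintype _ _ (by simp), Fintype.sum_prod_type]
  simp [biweight, Prod.snd_sum, Finset.sum_apply, Pi.single_apply]

end Weight

/-! ### Inserting repeated biletters. -/

section Words

variable {α β : Type*} [LinearOrder α]

theorem rowInsert_replicate_append (k : ℕ) {x p : α} (h : ¬ p < x) (r : List α) :
    rowInsert (List.replicate k x ++ r) p =
      (List.replicate k x ++ (rowInsert r p).1, (rowInsert r p).2) := by
  induction k with
  | zero => simp
  | succ k ih => simp [List.replicate_succ, rowInsert, h, ih]

theorem rowInsert_replicate (k : ℕ) {x p : α} (h : ¬ p < x) :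
    rowInsert (List.replicate k x) p = (List.replicate k x ++ [p], none) := by
  simpa [rowInsert] using rowInsert_replicate_append k h []

theorem foldl_biletterInsert_replicate (k : ℕ) {x : α} (c : ℕ) (y : β) (P : List (List α))
    (s : List β) (Q : List (List β)) :
    (List.replicate k (x, y)).foldl biletterInsert (List.replicate c x :: P, s :: Q) =
      (List.replicate (c + k) x :: P, (s ++ List.replicate k y) :: Q) := by
  induction k generalizing c s with
  | zero => simp
  | succ k ih =>
    have h : biletterInsert (List.replicate c x :: P, s :: Q) (x, y) =
        (List.replicate (c + 1) x :: P, (s ++ [y]) :: Q) := by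
      simp [biletterInsert, tableauInsert_cons, rowInsert_replicate, addBox,
        List.replicate_succ']
    rw [List.replicate_succ, List.foldl_cons, h, ih]
    simp [Nat.add_assoc, Nat.add_comm 1 k, List.replicate_succ]

/-- This and the next lemma display the one or two initial letters explicitly, the form in which
`rsk_padTable_table` meets them. -/
theorem foldl_biletterInsert_replicate_one (k : ℕ) {x : α} (y : β) (P : List (List α))
    (s : List β) (Q : List (List β)) :
    (List.replicate k (x, y)).foldl biletterInsert ([x] :: P, s :: Q) =
      ((x :: List.replicate k x) :: P, (s ++ List.replicate k y) :: Q) := by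
  simpa [Nat.add_comm, List.replicate_succ] using foldl_biletterInsert_replicate k 1 y P s Q

theorem foldl_biletterInsert_replicate_two (k : ℕ) {x : α} (y : β) (P : List (List α))
    (s : List β) (Q : List (List β)) :
    (List.replicate k (x, y)).foldl biletterInsert ([x, x] :: P, s :: Q) =
      ((x :: x :: List.replicate k x) :: P, (s ++ List.replicate k y) :: Q) := by
  simpa [Nat.add_comm, List.replicate_succ] using foldl_biletterInsert_replicate k 2 y P s Q

end Words

/-! ### Small minors and one-box columns. -/

section Bitableaux

variable {m n : ℕ}

@[simp] theorem minor_singleton (a : Fin m × Fin n) : minor [a] = MvPolynomial.X a :=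
  Matrix.det_fin_one _

theorem minor_pair (a b : Fin m × Fin n) :
    minor [a, b] = MvPolynomial.X a * MvPolynomial.X b -
      MvPolynomial.X (a.1, b.2) * MvPolynomial.X (b.1, a.2) :=
  Matrix.det_fin_two _

theorem minor_triple (a b c : Fin m × Fin n) :
    minor [a, b, c] =
      MvPolynomial.X a * MvPolynomial.X b * MvPolynomial.X c -
      MvPolynomial.X a * MvPolynomial.X (b.1, c.2) * MvPolynomial.X (c.1, b.2) -
      MvPolynomial.X (a.1, b.2) * MvPolynomial.X (b.1, a.2) * MvPolynomial.X c +
      MvPolynomial.X (a.1, b.2) * MvPolynomial.X (b.1, c.2) * MvPolynomial.X (c.1, a.2) +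
      MvPolynomial.X (a.1, c.2) * MvPolynomial.X (b.1, a.2) * MvPolynomial.X (c.1, b.2) -
      MvPolynomial.X (a.1, c.2) * MvPolynomial.X b * MvPolynomial.X (c.1, a.2) :=
  Matrix.det_fin_three _

theorem column_eq_nil {γ : Type*} {T : List (List γ)} {c : ℕ} (h : ∀ r ∈ T, r.length ≤ c) :
    column T c = [] := by
  rw [column, List.filterMap_eq_nil_iff]
  exact fun r hr => List.getElem?_eq_none (h r hr)

/-- The part of a bitableau to the right of all rows but the first is a monomial. -/
theorem bitableau_append (r₁ r₂ : List (Fin m)) (P : List (List (Fin m)))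
    (s₁ s₂ : List (Fin n)) (Q : List (List (Fin n)))
    (h₁ : s₁.length = r₁.length) (h₂ : s₂.length = r₂.length)
    (hP : ∀ r ∈ P, r.length ≤ r₁.length) (hQ : ∀ s ∈ Q, s.length ≤ r₁.length) :
    bitableau ((r₁ ++ r₂) :: P) ((s₁ ++ s₂) :: Q) =
      bitableau (r₁ :: P) (s₁ :: Q) * ((r₂.zip s₂).map MvPolynomial.X).prod := by
  simp only [bitableau, List.headD_cons, List.length_append, List.range_add, List.map_append,
    List.prod_append, List.map_map]
  congr 2
  · refine List.map_congr_left fun c hc => ?_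
    have hc : c < r₁.length := List.mem_range.mp hc
    simp only [column_cons, List.getElem?_append_left hc, List.getElem?_append_left (h₁ ▸ hc)]
  · refine List.ext_getElem (by simp [h₂]) fun c hc _ => ?_
    have hc : c < r₂.length := by simpa using hc
    have hs : c < s₂.length := h₂ ▸ hc
    have e₁ : (r₁ ++ r₂)[r₁.length + c]? = some r₂[c] := by simp [hc]
    have e₂ : (s₁ ++ s₂)[r₁.length + c]? = some s₂[c] := by simp [← h₁, hs]
    simp [column_cons, e₁, e₂, column_eq_nil fun r hr => (hP r hr).trans (Nat.le_add_right _ c),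
      column_eq_nil fun s hs => (hQ s hs).trans (Nat.le_add_right _ c)]

end Bitableaux

/-! ### The seven contingency tables of the chosen weight. -/

section Tables

variable {m n : ℕ}

/-- Extend a function on three indices by zero. -/
def pad {γ : Type*} [Zero γ] (f : Fin 3 → γ) : Fin (m + 3) → γ :=
  Matrix.vecCons (f 0) (Matrix.vecCons (f 1) (Matrix.vecCons (f 2) 0))

/-- The exponents of the monomial with exponents `A` in the upper left `3 × 3` variables. -/
noncomputable def padTable (A : Matrix (Fin 3) (Fin 3) ℕ) : Fin (m + 3) × Fin (n + 3) →₀ ℕ :=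
  Finsupp.equivFunOnFinite.symm fun x => pad (fun i => pad (A i)) x.1 x.2

theorem padTable_apply (A : Matrix (Fin 3) (Fin 3) ℕ) (i : Fin (m + 3)) (j : Fin (n + 3)) :
    padTable A (i, j) = pad (fun i => pad (A i)) i j := rfl

section pad

variable {γ : Type*} [Zero γ] (f : Fin 3 → γ)

@[simp] theorem pad_zero : (pad f : Fin (m + 3) → γ) 0 = f 0 := rfl
@[simp] theorem pad_one : (pad f : Fin (m + 3) → γ) 1 = f 1 := rfl
@[simp] theorem pad_two : (pad f : Fin (m + 3) → γ) 2 = f 2 := rfl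
@[simp] theorem pad_succ (i : Fin m) : (pad f : Fin (m + 3) → γ) i.succ.succ.succ = 0 := rfl

end pad

theorem forall_fin_add_three {p : Fin (m + 3) → Prop} :
    (∀ i, p i) ↔ p 0 ∧ p 1 ∧ p 2 ∧ ∀ i : Fin m, p i.succ.succ.succ := by
  simp [Fin.forall_fin_succ]

theorem sum_fin_add_three {γ : Type*} [AddCommMonoid γ] (f : Fin (m + 3) → γ) :
    ∑ i, f i = f 0 + f 1 + f 2 + ∑ i : Fin m, f i.succ.succ.succ := by
  simp [Fin.sum_univ_succ, add_assoc]

theorem prod_fin_add_three {γ : Type*} [CommMonoid γ] (f : Fin (m + 3) → γ) :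
    ∏ i, f i = f 0 * f 1 * f 2 * ∏ i : Fin m, f i.succ.succ.succ := by
  simp [Fin.prod_univ_succ, mul_assoc]

theorem flatMap_finRange_add_three {γ : Type*} (f : Fin (m + 3) → List γ)
    (h : ∀ i : Fin m, f i.succ.succ.succ = []) :
    (List.finRange (m + 3)).flatMap f = f 0 ++ f 1 ++ f 2 := by
  simp [List.finRange_succ, List.flatMap_map, Function.comp_def, h]

theorem biword_padTable (A : Matrix (Fin 3) (Fin 3) ℕ) :
    biword (padTable A : Fin (m + 3) × Fin (n + 3) →₀ ℕ) =
      (List.replicate (A 0 0) (0, 0) ++ List.replicate (A 1 0) (1, 0) ++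
        List.replicate (A 2 0) (2, 0)) ++
      (List.replicate (A 0 1) (0, 1) ++ List.replicate (A 1 1) (1, 1) ++
        List.replicate (A 2 1) (2, 1)) ++
      (List.replicate (A 0 2) (0, 2) ++ List.replicate (A 1 2) (1, 2) ++
        List.replicate (A 2 2) (2, 2)) := by
  have h (j : Fin (n + 3)) : ((List.finRange (m + 3)).flatMap fun i =>
      List.replicate (padTable A (i, j)) (i, j)) =
      List.replicate (padTable A ((0 : Fin (m + 3)), j)) (0, j) ++
      List.replicate (padTable A ((1 : Fin (m + 3)), j)) (1, j) ++
      List.replicate (padTable A ((2 : Fin (m + 3)), j)) (2, j) :=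
    flatMap_finRange_add_three _ fun i => by simp [padTable_apply]
  simp only [biword, h]
  rw [flatMap_finRange_add_three]
  · simp [padTable_apply]
  · simp [padTable_apply]

theorem monomial_padTable (A : Matrix (Fin 3) (Fin 3) ℕ) :
    (MvPolynomial.monomial (padTable A) 1 : MvPolynomial (Fin (m + 3) × Fin (n + 3)) ℂ) =
      MvPolynomial.X (0, 0) ^ A 0 0 * MvPolynomial.X (0, 1) ^ A 0 1 *
        MvPolynomial.X (0, 2) ^ A 0 2 *
      (MvPolynomial.X (1, 0) ^ A 1 0 * MvPolynomial.X (1, 1) ^ A 1 1 *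
        MvPolynomial.X (1, 2) ^ A 1 2) *
      (MvPolynomial.X (2, 0) ^ A 2 0 * MvPolynomial.X (2, 1) ^ A 2 1 *
        MvPolynomial.X (2, 2) ^ A 2 2) := by
  rw [MvPolynomial.monomial_eq, Finsupp.prod_fintype _ _ (by simp), Fintype.prod_prod_type]
  simp [prod_fin_add_three, padTable_apply]

/-- The contingency tables with row margins `(k + 2, 1, 1)` and column margins `(1, k + 2, 1)`. -/
def table (k : ℕ) : Fin 7 → Matrix (Fin 3) (Fin 3) ℕ :=
  ![!![0, k + 1, 1; 1, 0, 0; 0, 1, 0],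
    !![0, k + 2, 0; 1, 0, 0; 0, 0, 1],
    !![0, k + 1, 1; 0, 1, 0; 1, 0, 0],
    !![1, k, 1; 0, 1, 0; 0, 1, 0],
    !![1, k + 1, 0; 0, 1, 0; 0, 0, 1],
    !![0, k + 2, 0; 0, 0, 1; 1, 0, 0],
    !![1, k + 1, 0; 0, 0, 1; 0, 1, 0]]

theorem table_injective (k : ℕ) : Function.Injective (table k) := by
  intro s t h
  -- The first two entries of the last two rows already distinguish the seven tables.
  have h1 := congrFun (congrFun h 1)
  have h2 := congrFun (congrFun h 2)
  have h10 := h1 0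
  have h11 := h1 1
  have h20 := h2 0
  have h21 := h2 1
  revert h10 h11 h20 h21
  clear h h1 h2
  fin_cases s <;> fin_cases t <;> simp [table]

theorem padTable_injective :
    Function.Injective (padTable : _ → Fin (m + 3) × Fin (n + 3) →₀ ℕ) := by
  intro A B h
  ext i j
  have h (i : Fin (m + 3)) (j : Fin (n + 3)) := DFunLike.congr_fun h (i, j)
  simp only [padTable_apply] at h
  fin_cases i <;> fin_cases j
  exacts [h 0 0, h 0 1, h 0 2, h 1 0, h 1 1, h 1 2, h 2 0, h 2 1, h 2 2]

/-- Each of the last two rows is a unit vector, and they determine the first row. Of the nine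
choices, the column sums rule out two: both units in the first column, or both in the third. -/
theorem exists_table_eq {k : ℕ} {A : Matrix (Fin 3) (Fin 3) ℕ}
    (hr : ∀ i, ∑ j, A i j = ![k + 2, 1, 1] i) (hc : ∀ j, ∑ i, A i j = ![1, k + 2, 1] j) :
    ∃ s, A = table k s := by
  simp only [Fin.forall_fin_succ, Fin.sum_univ_three] at hr hc
  simp at hr hc
  have h1 : A 1 0 = 1 ∧ A 1 1 = 0 ∧ A 1 2 = 0 ∨ A 1 0 = 0 ∧ A 1 1 = 1 ∧ A 1 2 = 0 ∨
    A 1 0 = 0 ∧ A 1 1 = 0 ∧ A 1 2 = 1 := by omega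
  have h2 : A 2 0 = 1 ∧ A 2 1 = 0 ∧ A 2 2 = 0 ∨ A 2 0 = 0 ∧ A 2 1 = 1 ∧ A 2 2 = 0 ∨
    A 2 0 = 0 ∧ A 2 1 = 0 ∧ A 2 2 = 1 := by omega
  have key (B : Matrix (Fin 3) (Fin 3) ℕ) (h0 : A 0 0 = B 0 0 ∧ A 0 1 = B 0 1 ∧ A 0 2 = B 0 2)
      (h1 : A 1 0 = B 1 0 ∧ A 1 1 = B 1 1 ∧ A 1 2 = B 1 2)
      (h2 : A 2 0 = B 2 0 ∧ A 2 1 = B 2 1 ∧ A 2 2 = B 2 2) : A = B := by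
    ext i j
    fin_cases i <;> fin_cases j <;> simp_all
  rcases h1 with h1 | h1 | h1 <;> rcases h2 with h2 | h2 | h2
  · omega
  · exact ⟨0, key _ (by simp [table]; omega) (by simpa [table]) (by simpa [table])⟩
  · exact ⟨1, key _ (by simp [table]; omega) (by simpa [table]) (by simpa [table])⟩
  · exact ⟨2, key _ (by simp [table]; omega) (by simpa [table]) (by simpa [table])⟩
  · exact ⟨3, key _ (by simp [table]; omega) (by simpa [table]) (by simpa [table])⟩
  · exact ⟨4, key _ (by simp [table]; omega) (by simpa [table]) (by simpa [table])⟩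
  · exact ⟨5, key _ (by simp [table]; omega) (by simpa [table]) (by simpa [table])⟩
  · exact ⟨6, key _ (by simp [table]; omega) (by simpa [table]) (by simpa [table])⟩
  · omega

/-- The weight of the tables `table k`. -/
def tableWeight (m n k : ℕ) : (Fin (m + 3) → ℕ) × (Fin (n + 3) → ℕ) :=
  (pad ![k + 2, 1, 1], pad ![1, k + 2, 1])

theorem weight_padTable_table (k : ℕ) (s : Fin 7) :
    Finsupp.weight biweight (padTable (table k s)) = tableWeight m n k := by
  refine Prod.ext (funext fun i => ?_) (funext fun j => ?_)
  · rw [weight_biweight_fst]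
    revert i
    simp only [forall_fin_add_three, sum_fin_add_three, padTable_apply]
    fin_cases s <;> simp [table, tableWeight] <;> omega
  · rw [weight_biweight_snd]
    revert j
    simp only [forall_fin_add_three, sum_fin_add_three, padTable_apply]
    fin_cases s <;> simp [table, tableWeight]

theorem exists_padTable_table_eq {k : ℕ} {a : Fin (m + 3) × Fin (n + 3) →₀ ℕ}
    (h : Finsupp.weight biweight a = tableWeight m n k) : ∃ s, padTable (table k s) = a := by
  have hr (i : Fin (m + 3)) : ∑ j, a (i, j) = pad ![k + 2, 1, 1] i := by
    rw [← weight_biweight_fst, h, tableWeight]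
  have hc (j : Fin (n + 3)) : ∑ i, a (i, j) = pad ![1, k + 2, 1] j := by
    rw [← weight_biweight_snd, h, tableWeight]
  have hr0 (i : Fin m) (j) : a (i.succ.succ.succ, j) = 0 := by
    have := hr i.succ.succ.succ
    rw [pad_succ, Finset.sum_eq_zero_iff] at this
    exact this j (Finset.mem_univ j)
  have hc0 (j : Fin n) (i) : a (i, j.succ.succ.succ) = 0 := by
    have := hc j.succ.succ.succ
    rw [pad_succ, Finset.sum_eq_zero_iff] at this
    exact this i (Finset.mem_univ i)
  let A : Matrix (Fin 3) (Fin 3) ℕ :=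
    !![a (0, 0), a (0, 1), a (0, 2); a (1, 0), a (1, 1), a (1, 2); a (2, 0), a (2, 1), a (2, 2)]
  have hA : padTable A = a := by
    ext ⟨i, j⟩
    revert i j
    simp only [forall_fin_add_three, padTable_apply, hr0, hc0]
    simp [A]
  obtain ⟨s, hs⟩ : ∃ s, A = table k s := by
    refine exists_table_eq ?_ ?_
    · simp only [forall_fin_add_three, sum_fin_add_three, hr0, hc0] at hr
      simpa [Fin.forall_fin_succ, Fin.sum_univ_three, A] using hr
    · simp only [forall_fin_add_three, sum_fin_add_three, hr0, hc0] at hc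
      simpa [Fin.forall_fin_succ, Fin.sum_univ_three, A] using hc
  exact ⟨s, by rw [← hs, hA]⟩

end Tables

/-! ### The operator on the seven monomials. -/

section Block

variable {m n : ℕ}

theorem fin_add_three_lt :
    (0 : Fin (m + 3)) < 1 ∧ (0 : Fin (m + 3)) < 2 ∧ (1 : Fin (m + 3)) < 2 := by
  simp [Fin.lt_def, Nat.mod_eq_of_lt]

/-- The matrix of the operator on the monomials with exponents `table k`. -/
def blockMatrix : Matrix (Fin 7) (Fin 7) ℤ :=
  !![1, 0, 1, -1, 0, 0, 0;
    -1, -1, -1, 0, 0, 0, 0;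
    0, 0, -1, 0, 0, 0, -1;
    -1, 0, 0, 0, 0, 0, 0;
    1, 1, 1, 0, 1, 0, 1;
    0, 0, 1, 0, 0, -1, 0;
    0, 0, -1, 1, 0, 1, 0]

theorem replicate_append_cons_self {α : Type*} (k : ℕ) (x : α) (l : List α) :
    List.replicate k x ++ x :: l = x :: (List.replicate k x ++ l) := by
  rw [← List.singleton_append, ← List.append_assoc, ← List.replicate_succ', List.replicate_succ,
    List.cons_append]

theorem zip_replicate_append {α β : Type*} (k : ℕ) (x : α) (y : β) (l : List α) (l' : List β) :
    (List.replicate k x ++ l).zip (List.replicate k y ++ l') =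
      List.replicate k (x, y) ++ l.zip l' := by
  rw [List.zip_append (by simp), List.zip_replicate']

/-- The prefixes `[0, 0]` and `[0]` are at least as long as every lower row. All boxes after them
are one-box columns, as `bitableau_append` requires, and `k` occurs only there. -/
theorem rsk_padTable_table (k : ℕ) (s : Fin 7) :
    rsk (padTable (table k s) : Fin (m + 3) × Fin (n + 3) →₀ ℕ) =
      (![[[0, 0] ++ List.replicate k 0, [1, 2]],
          [[0] ++ (List.replicate (k + 1) 0 ++ [2]), [1]],
          [[0] ++ List.replicate (k + 1) 0, [1], [2]],
          [[0] ++ (List.replicate (k + 1) 0 ++ [2]), [1]],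
          [[0] ++ (List.replicate (k + 1) 0 ++ [1, 2])],
          [[0] ++ (List.replicate (k + 1) 0 ++ [1]), [2]],
          [[0] ++ (List.replicate (k + 1) 0 ++ [1]), [2]]] s,
        ![[[0, 1] ++ List.replicate k 1, [1, 2]],
          [[0] ++ (List.replicate (k + 1) 1 ++ [2]), [1]],
          [[0] ++ List.replicate (k + 1) 1, [1], [2]],
          [[0] ++ (List.replicate (k + 1) 1 ++ [1]), [2]],
          [[0] ++ (List.replicate (k + 1) 1 ++ [1, 2])],
          [[0] ++ (List.replicate (k + 1) 1 ++ [2]), [1]],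
          [[0] ++ (List.replicate (k + 1) 1 ++ [1]), [2]]] s) := by
  obtain ⟨h01, h02, h12⟩ := fin_add_three_lt (m := m)
  rw [rsk, biword_padTable]
  fin_cases s <;> simp [table, List.replicate_succ, biletterInsert,
    tableauInsert, rowInsert, addBox, foldl_biletterInsert_replicate_one,
    foldl_biletterInsert_replicate_two, rowInsert_replicate, rowInsert_replicate_append, h01, h02,
    h12, h01.not_gt, h02.not_gt, h12.not_gt, replicate_append_cons_self]

/-- The operator maps the span of the monomials with exponents `table k` to itself. -/
theorem operator_monomial_table (k : ℕ) (s : Fin 7) :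
    operator (m + 3) (n + 3) (MvPolynomial.monomial (padTable (table k s)) 1) =
      ∑ t, MvPolynomial.monomial (padTable (table k t)) (blockMatrix t s : ℂ) := by
  have hM (t : Fin 7) : (MvPolynomial.monomial (padTable (table k t)) (blockMatrix t s : ℂ) :
      MvPolynomial (Fin (m + 3) × Fin (n + 3)) ℂ) =
      (blockMatrix t s : MvPolynomial (Fin (m + 3) × Fin (n + 3)) ℂ) *
        MvPolynomial.monomial (padTable (table k t)) 1 := by
    rw [← map_intCast (MvPolynomial.C : ℂ →+* _), MvPolynomial.C_mul_monomial, mul_one]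
  rw [operator_monomial, rsk_padTable_table]
  simp only [hM, monomial_padTable]
  simp only [Fin.sum_univ_succ]
  fin_cases s
  all_goals
    simp only [Fin.zero_eta, Fin.isValue, Fin.mk_one, Fin.reduceFinMk, Matrix.cons_val]
  all_goals
    -- This splits off the one-box columns, and with them all dependence on `k`. An identity between
    -- products of minors of size at most three remains.
    rw [bitableau_append _ _ _ _ _ _ (by simp) (by simp) (by simp) (by simp)]
    simp [bitableau, column, minor_pair, minor_triple, table, blockMatrix, List.range_succ,
      zip_replicate_append]
    ring

end Block

/-! ### The quintic: irreducibility, real roots, Galois group. -/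

section Quintic

/-- The quintic over the integers. -/
noncomputable def intQuintic : ℤ[X] :=
  X ^ 5 + X ^ 4 - 3 * X ^ 3 - 2 * X ^ 2 - X - 1

theorem intQuintic_map {R : Type*} [CommRing R] (f : ℤ →+* R) :
    intQuintic.map f = X ^ 5 + X ^ 4 - 3 * X ^ 3 - 2 * X ^ 2 - X - 1 := by
  simp [intQuintic]

theorem monic_intQuintic : intQuintic.Monic := by
  unfold intQuintic; monicity!

theorem natDegree_quintic : quintic.natDegree = 5 := by
  unfold quintic; compute_degree!

theorem monic_quintic : quintic.Monic := by
  unfold quintic; monicity!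

theorem irreducible_intQuintic_map_zmod_two :
    Irreducible (intQuintic.map (Int.castRingHom (ZMod 2))) := by
  have hm : (intQuintic.map (Int.castRingHom (ZMod 2))).Monic := monic_intQuintic.map _
  have hd : (intQuintic.map (Int.castRingHom (ZMod 2))).natDegree = 5 := by
    rw [monic_intQuintic.natDegree_map]; unfold intQuintic; compute_degree!
  -- It suffices to exclude monic factors of degrees 1 and 2. There is no root modulo 2, and the
  -- only quadratic without a root there is `X ^ 2 + X + 1`, which leaves the remainder `X + 1`.
  rw [hm.irreducible_iff_lt_natDegree_lt (fun h => by simp [h] at hd), hd]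
  have hroot (x : ZMod 2) : (intQuintic.map (Int.castRingHom (ZMod 2))).eval x ≠ 0 := by
    rw [intQuintic_map]
    simp only [eval_sub, eval_add, eval_pow, eval_X, eval_mul, eval_ofNat, eval_one]
    revert x
    decide
  have hnr (q : (ZMod 2)[X]) (hq : q ∣ intQuintic.map (Int.castRingHom (ZMod 2))) (x : ZMod 2) :
      q.eval x ≠ 0 := fun h => by
    obtain ⟨g, hg⟩ := hq
    exact hroot x (by rw [hg, eval_mul, h, zero_mul])
  intro q hq hqd hdvd
  rw [show (5 : ℕ) / 2 = 2 from rfl, Finset.mem_Ioc] at hqd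
  have h01 : ∀ x : ZMod 2, x ≠ 0 → x = 1 := by decide
  obtain h | h : q.natDegree = 1 ∨ q.natDegree = 2 := by omega
  · have hqe := hq.eq_X_add_C h
    refine hnr q hdvd (-q.coeff 0) ?_
    rw [hqe]; simp [CharTwo.add_self_eq_zero]
  · have hqe : q = X ^ 2 + C (q.coeff 1) * X + C (q.coeff 0) := by
      conv_lhs => rw [q.as_sum_range, h]
      have h2 : q.coeff 2 = 1 := by simpa [h] using hq.coeff_natDegree
      simp [Finset.sum_range_succ, ← C_mul_X_pow_eq_monomial, h2]
      ring
    have h0 := hnr q hdvd 0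
    have h1 := hnr q hdvd 1
    rw [hqe] at h0 h1
    have e0 : q.coeff 0 = 1 := h01 _ (by simpa using h0)
    have e1 : q.coeff 1 = 1 := by
      refine h01 _ fun h => h1 ?_
      simp [h, e0]
      decide
    rw [hqe, e0, e1] at hdvd
    have hrep : intQuintic.map (Int.castRingHom (ZMod 2)) =
        (X ^ 2 + C 1 * X + C 1) * X ^ 3 + (X + C 1) := by
      have h2 : (2 : (ZMod 2)[X]) = 0 := CharTwo.two_eq_zero
      rw [intQuintic_map]
      simp only [map_one, one_mul]
      linear_combination (-2 * X ^ 3 - X ^ 2 - X - 1) * h2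
    rw [hrep, dvd_add_right (dvd_mul_right _ _)] at hdvd
    have hle := natDegree_le_of_dvd hdvd (X_add_C_ne_zero 1)
    have hdeg : (X ^ 2 + C 1 * X + C 1 : (ZMod 2)[X]).natDegree = 2 := by compute_degree!
    rw [natDegree_X_add_C, hdeg] at hle
    omega

theorem irreducible_quintic : Irreducible quintic := by
  have h : Irreducible intQuintic :=
    monic_intQuintic.irreducible_of_irreducible_map _ _ irreducible_intQuintic_map_zmod_two
  have := (monic_intQuintic.irreducible_iff_irreducible_map_fraction_map (K := ℚ)).mp h
  rwa [show intQuintic.map (algebraMap ℤ ℚ) = quintic from intQuintic_map _] at this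

theorem mem_rootSet_quintic {K : Type*} [Field K] [Algebra ℚ K] {x : K} :
    x ∈ quintic.rootSet K ↔ x ^ 5 + x ^ 4 - 3 * x ^ 3 - 2 * x ^ 2 - x - 1 = 0 := by
  rw [mem_rootSet_of_ne monic_quintic.ne_zero]
  simp [quintic, map_ofNat]

theorem ncard_rootSet_quintic_real : (quintic.rootSet ℝ).ncard = 3 := by
  let f : ℝ → ℝ := fun x => x ^ 5 + x ^ 4 - 3 * x ^ 3 - 2 * x ^ 2 - x - 1
  have hf : Continuous f := by fun_prop
  -- The function is monotone on `(-∞, -2]`, `[-1, 1]` and `[13/10, ∞)`, with one sign change on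
  -- each. It has no zero in the two gaps, where the remaining critical points lie; `13/10` is a
  -- convenient point beyond the last one.
  obtain ⟨a, ha, hfa⟩ : (0 : ℝ) ∈ f '' Set.Icc (-3) (-2) :=
    intermediate_value_Icc (by norm_num) hf.continuousOn (by norm_num [f])
  obtain ⟨b, hb, hfb⟩ : (0 : ℝ) ∈ f '' Set.Icc (-1) 0 :=
    intermediate_value_Icc' (by norm_num) hf.continuousOn (by norm_num [f])
  obtain ⟨c, hc, hfc⟩ : (0 : ℝ) ∈ f '' Set.Icc (13 / 10) 2 :=
    intermediate_value_Icc (by norm_num) hf.continuousOn (by norm_num [f])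
  have hder (x : ℝ) : deriv f x = 5 * x ^ 4 + 4 * x ^ 3 - 9 * x ^ 2 - 4 * x - 1 := by
    have h := (((((hasDerivAt_id x).pow 5).add ((hasDerivAt_id x).pow 4)).sub
      (((hasDerivAt_id x).pow 3).const_mul 3)).sub (((hasDerivAt_id x).pow 2).const_mul 2)).sub
      (hasDerivAt_id x) |>.sub_const 1
    refine (HasDerivAt.deriv (f := f) h).trans ?_
    simp
    ring
  have hleft : StrictMonoOn f (Set.Iic (-2)) := by
    refine strictMonoOn_of_deriv_pos (convex_Iic _) hf.continuousOn fun x hx => ?_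
    rw [interior_Iic, Set.mem_Iio] at hx
    obtain ⟨y, hy, rfl⟩ : ∃ y, 0 < y ∧ x = -2 - y := ⟨-2 - x, by linarith, by ring⟩
    rw [hder, show 5 * (-2 - y) ^ 4 + 4 * (-2 - y) ^ 3 - 9 * (-2 - y) ^ 2 - 4 * (-2 - y) - 1 =
      5 * y ^ 4 + 36 * y ^ 3 + 87 * y ^ 2 + 80 * y + 19 by ring]
    positivity
  have hmid : StrictAntiOn f (Set.Icc (-1) 1) := by
    refine strictAntiOn_of_deriv_neg (convex_Icc _ _) hf.continuousOn fun x hx => ?_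
    rw [interior_Icc, Set.mem_Ioo] at hx
    have hu : 0 ≤ 1 - x ^ 2 := by nlinarith
    rw [hder]
    -- The derivative equals `-5(1 - x²)(x + 2/5)² - (24/5)x² - 1/5`.
    nlinarith [mul_nonneg hu (sq_nonneg (x + 2 / 5)), sq_nonneg x]
  have hright : StrictMonoOn f (Set.Ici (13 / 10)) := by
    refine strictMonoOn_of_deriv_pos (convex_Ici _) hf.continuousOn fun x hx => ?_
    rw [interior_Ici, Set.mem_Ioi] at hx
    obtain ⟨y, hy, rfl⟩ : ∃ y, 0 < y ∧ x = 13 / 10 + y := ⟨x - 13 / 10, by linarith, by ring⟩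
    rw [hder, show 5 * (13 / 10 + y) ^ 4 + 4 * (13 / 10 + y) ^ 3 - 9 * (13 / 10 + y) ^ 2 -
      4 * (13 / 10 + y) - 1 =
      5 * y ^ 4 + 30 * y ^ 3 + 573 / 10 * y ^ 2 + 1841 / 50 * y + 3317 / 2000 by ring]
    positivity
  have hpos (x : ℝ) (h1 : -2 < x) (h2 : x < -1) : 0 < f x := by
    obtain ⟨y, hy, rfl⟩ : ∃ y, 0 < y ∧ x = -1 - y := ⟨-1 - x, by linarith, by ring⟩
    have hy1 : y ≤ 1 := by linarith
    have h3 := pow_le_pow_of_le_one hy.le hy1 (show 2 ≤ 3 by norm_num)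
    have h4 := pow_le_of_le_one hy.le hy1 (show 4 ≠ 0 by norm_num)
    have h5 := pow_le_of_le_one hy.le hy1 (show 5 ≠ 0 by norm_num)
    rw [show f (-1 - y) = 1 + 5 * y + 3 * y ^ 2 - 3 * y ^ 3 - 4 * y ^ 4 - y ^ 5 by
      simp only [f]; ring]
    -- By `h3`, `h4` and `h5` the value is at least `1`: `y ^ 3 ≤ y ^ 2`, while `4y ^ 4 + y ^ 5 ≤
    -- 5y`.
    linarith
  have hneg (x : ℝ) (h1 : 1 < x) (h2 : x < 13 / 10) : f x < 0 := by
    obtain ⟨y, hy, rfl⟩ : ∃ y, 0 < y ∧ x = 1 + y := ⟨x - 1, by linarith, by ring⟩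
    have hy1 : y ≤ 1 := by linarith
    have hy2 : y ^ 2 ≤ 9 / 100 := by nlinarith
    have h3 := pow_le_pow_of_le_one hy.le hy1 (show 2 ≤ 3 by norm_num)
    have h4 := pow_le_pow_of_le_one hy.le hy1 (show 2 ≤ 4 by norm_num)
    have h5 := pow_le_pow_of_le_one hy.le hy1 (show 2 ≤ 5 by norm_num)
    rw [show f (1 + y) = -5 - 5 * y + 5 * y ^ 2 + 11 * y ^ 3 + 6 * y ^ 4 + y ^ 5 by
      simp only [f]; ring]
    -- All higher powers are at most `y ^ 2 ≤ 9/100`, so the positive terms sum to at most `23 ·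
    -- 9/100 < 5`.
    linarith
  rw [Set.mem_Icc] at ha hb hc
  refine Set.ncard_eq_three.mpr ⟨a, b, c, by linarith, by linarith, by linarith, ?_⟩
  ext x
  rw [mem_rootSet_quintic]
  change f x = 0 ↔ _
  simp only [Set.mem_insert_iff, Set.mem_singleton_iff]
  refine ⟨fun hx => ?_, ?_⟩
  · rcases le_or_gt x (-2) with h1 | h1
    · exact .inl (hleft.injOn h1 ha.2 (hx.trans hfa.symm))
    rcases lt_or_ge x (-1) with h2 | h2
    · exact absurd hx (hpos x h1 h2).ne'
    rcases le_or_gt x 1 with h3 | h3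
    · exact .inr (.inl (hmid.injOn ⟨h2, h3⟩ ⟨hb.1, by linarith⟩ (hx.trans hfb.symm)))
    rcases lt_or_ge x (13 / 10) with h4 | h4
    · exact absurd hx (hneg x h3 h4).ne
    · exact .inr (.inr (hright.injOn h4 hc.1 (hx.trans hfc.symm)))
  · rintro (rfl | rfl | rfl) <;> assumption

theorem card_rootSet_quintic_complex : Fintype.card (quintic.rootSet ℂ) = 5 := by
  rw [card_rootSet_eq_natDegree irreducible_quintic.separable (IsAlgClosed.splits _),
    natDegree_quintic]

instance fact_splits_quintic : Fact (quintic.map (algebraMap ℚ ℂ)).Splits :=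
  ⟨IsAlgClosed.splits _⟩

/-- Five complex roots against three real ones: exactly one conjugate pair, hence a transposition.
-/
theorem bijective_galActionHom_quintic : Function.Bijective (Gal.galActionHom quintic ℂ) := by
  refine Gal.galActionHom_bijective_of_prime_degree irreducible_quintic
    (by rw [natDegree_quintic]; norm_num) ?_
  rw [card_rootSet_quintic_complex, ← Nat.card_eq_fintype_card, Nat.card_coe_set_eq,
    ncard_rootSet_quintic_real]

theorem nonempty_gal_quintic_mulEquiv : Nonempty (quintic.Gal ≃* Equiv.Perm (Fin 5)) := by
  have hcard : Fintype.card (quintic.rootSet ℂ) = Fintype.card (Fin 5) := by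
    rw [card_rootSet_quintic_complex, Fintype.card_fin]
  exact ⟨(MulEquiv.ofBijective _ bijective_galActionHom_quintic).trans
    (Fintype.equivOfCardEq hcard).permCongrHom⟩

theorem not_mem_solvableByRad_of_quintic {x : ℂ} (hx : x ∈ quintic.rootSet ℂ) :
    x ∉ solvableByRad ℚ ℂ := fun h => by
  have := isSolvable_gal_of_irreducible h irreducible_quintic (aeval_eq_zero_of_mem_rootSet hx)
  obtain ⟨e⟩ := nonempty_gal_quintic_mulEquiv
  exact Equiv.Perm.not_isSolvable_fin_5 (Group.isSolvable_of_surjective (f := e.toMonoidHom) e.surjective)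

end Quintic

/-! ### The characteristic polynomial of the block. -/

/-- A companion matrix. -/
def companionSeven : Matrix (Fin 7) (Fin 7) ℤ :=
  !![0, 0, 0, 0, 0, 0, -1;
    1, 0, 0, 0, 0, 0, -1;
    0, 1, 0, 0, 0, 0, -1;
    0, 0, 1, 0, 0, 0, -2;
    0, 0, 0, 1, 0, 0, 3;
    0, 0, 0, 0, 1, 0, 4;
    0, 0, 0, 0, 0, 1, -1]

/-- The iterates of a cyclic vector of `blockMatrix`. -/
def cyclicBasis : Matrix (Fin 7) (Fin 7) ℤ :=
  !![-1, 0, 0, 0, 0, -1, 1; 1, 0, -1, 1, -1, 2, -3; 0, 1, 0, 0, -1, 2, -4; -1, 1, 0, 0, 0, 0, 1;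
    1, 0, 0, -1, 1, -2, 3; 0, 0, 1, -1, 1, -2, 4; -1, -1, 0, 1, -1, 2, -4]

/-- The inverse of `cyclicBasis`. -/
def cyclicBasisInv : Matrix (Fin 7) (Fin 7) ℤ :=
  !![0, 0, 0, -1, -1, 0, -1; 0, -1, 0, -1, -2, -1, -2; 0, -1, 0, -2, -3, 0, -2;
    0, -2, -1, -3, -5, -2, -4; -2, -3, -1, -1, -2, -3, -2; -1, 1, 0, 2, 2, 1, 2;
    0, 1, 0, 1, 1, 1, 1]

/-- Multiplying by the unipotent `W` adds `X ^ i` times row `i` to row `0`. This clears row `0`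
except for its last entry, which becomes the polynomial; the complementary minor is triangular with
six diagonal entries `-1`. -/
theorem charpoly_companionSeven : companionSeven.charpoly =
    (X - 1) * (X + 1) * (X ^ 5 + X ^ 4 - 3 * X ^ 3 - 2 * X ^ 2 - X - 1) := by
  let W : Matrix (Fin 7) (Fin 7) ℤ[X] :=
    !![1, X, X ^ 2, X ^ 3, X ^ 4, X ^ 5, X ^ 6; 0, 1, 0, 0, 0, 0, 0; 0, 0, 1, 0, 0, 0, 0;
      0, 0, 0, 1, 0, 0, 0; 0, 0, 0, 0, 1, 0, 0; 0, 0, 0, 0, 0, 1, 0; 0, 0, 0, 0, 0, 0, 1]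
  have hW : W.det = 1 := by
    rw [Matrix.det_of_isUpperTriangular]
    · simp [W, Fin.prod_univ_succ]
    · intro i j hij
      fin_cases i <;> fin_cases j <;> first | rfl | exact absurd hij (by decide)
  have h : W * companionSeven.charmatrix =
      !![0, 0, 0, 0, 0, 0, (X - 1) * (X + 1) * (X ^ 5 + X ^ 4 - 3 * X ^ 3 - 2 * X ^ 2 - X - 1);
        -1, X, 0, 0, 0, 0, 1;
        0, -1, X, 0, 0, 0, 1;
        0, 0, -1, X, 0, 0, 2;
        0, 0, 0, -1, X, 0, -3;
        0, 0, 0, 0, -1, X, -4;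
        0, 0, 0, 0, 0, -1, X + 1] := by
    ext i j : 1
    fin_cases i <;> fin_cases j <;>
      simp [W, companionSeven, Matrix.charmatrix_apply, Matrix.diagonal,
        Matrix.mul_apply, Fin.sum_univ_succ] <;> ring
  have hdet := Matrix.det_mul W companionSeven.charmatrix
  rw [hW, one_mul] at hdet
  rw [Matrix.charpoly, ← hdet, h, Matrix.det_succ_row_zero, Finset.sum_eq_single 6]
  · rw [Matrix.det_of_isUpperTriangular]
    · simp [Fin.prod_univ_succ, Fin.succAbove]
      ring
    · intro i j hij
      fin_cases i <;> fin_cases j <;> first | rfl | exact absurd hij (by decide)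
  · intro j _ hj
    fin_cases j <;> first | exact absurd rfl hj | simp
  · simp

theorem charpoly_blockMatrix : blockMatrix.charpoly =
    (X - 1) * (X + 1) * (X ^ 5 + X ^ 4 - 3 * X ^ 3 - 2 * X ^ 2 - X - 1) := by
  have h : blockMatrix = cyclicBasis * (companionSeven * cyclicBasisInv) := by decide
  have h1 : cyclicBasisInv * cyclicBasis = 1 := by decide
  rw [h, Matrix.charpoly_mul_comm, Matrix.mul_assoc, h1, Matrix.mul_one, charpoly_companionSeven]

/-! ### Integrality of the matrix entries. -/

section Integrality

variable {m n : ℕ}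

theorem minor_mem_range_map_intCast (l : List (Fin m × Fin n)) :
    minor l ∈ (MvPolynomial.map (Int.castRingHom ℂ) :
      MvPolynomial (Fin m × Fin n) ℤ →+* MvPolynomial (Fin m × Fin n) ℂ).range := by
  refine ⟨Matrix.det (Matrix.of fun a b : Fin l.length =>
    MvPolynomial.X ((l.get a).1, (l.get b).2)), ?_⟩
  rw [RingHom.map_det, minor]
  congr 1
  ext a b : 1
  simp

theorem exists_intCast_eq_coeff_operator (a b : Fin m × Fin n →₀ ℕ) :
    ∃ z : ℤ, MvPolynomial.coeff b (operator m n (MvPolynomial.monomial a 1)) = z := by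
  obtain ⟨p, hp⟩ : bitableau (rsk a).1 (rsk a).2 ∈ (MvPolynomial.map (Int.castRingHom ℂ) :
      MvPolynomial (Fin m × Fin n) ℤ →+* MvPolynomial (Fin m × Fin n) ℂ).range := by
    refine Subring.list_prod_mem _ fun x hx => ?_
    obtain ⟨c, -, rfl⟩ := List.mem_map.mp hx
    exact minor_mem_range_map_intCast _
  exact ⟨p.coeff b, by rw [operator_monomial, ← hp, MvPolynomial.coeff_map]; rfl⟩

theorem exists_matrixOn_eq_map (S : Finset (Fin m × Fin n →₀ ℕ)) :
    ∃ M : Matrix S S ℤ, matrixOn S = M.map (Int.castRingHom ℂ) := by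
  choose z hz using fun a b : Fin m × Fin n →₀ ℕ => exists_intCast_eq_coeff_operator a b
  exact ⟨Matrix.of fun b a => z a.1 b.1, by ext b a; exact hz a.1 b.1⟩

end Integrality

/-! ### The block inside the degree matrix. -/

section Blocks

variable {m n : ℕ}

theorem mem_exponents {d : ℕ} {a : Fin m × Fin n →₀ ℕ} :
    a ∈ exponents m n d ↔ ∑ i, (Finsupp.weight biweight a).1 i = d := by
  simp [exponents, weight_biweight_fst, Fintype.sum_prod_type]

theorem mem_contingencyTables {σ : Fin m → ℕ} {π : Fin n → ℕ} {a : Fin m × Fin n →₀ ℕ} :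
    a ∈ contingencyTables σ π ↔ Finsupp.weight biweight a = (σ, π) := by
  rw [contingencyTables, Finset.mem_filter, mem_exponents, Prod.ext_iff, funext_iff, funext_iff]
  simp only [weight_biweight_fst, weight_biweight_snd, and_iff_right_iff_imp]
  exact fun h => Finset.sum_congr rfl fun i _ => h.1 i

theorem coeff_operator_table (k : ℕ) (t s : Fin 7) :
    MvPolynomial.coeff (padTable (table k t))
      (operator (m + 3) (n + 3) (MvPolynomial.monomial (padTable (table k s)) 1)) =
        blockMatrix t s := by
  rw [operator_monomial_table, MvPolynomial.coeff_sum, Finset.sum_eq_single t]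
  · rw [MvPolynomial.coeff_monomial, if_pos rfl]
  · intro u _ hu
    rw [MvPolynomial.coeff_monomial, if_neg]
    exact fun h => hu (table_injective k (padTable_injective h))
  · simp

theorem bijective_padTable_table (k : ℕ) : Function.Bijective fun s : Fin 7 =>
    (⟨padTable (table k s), weight_padTable_table k s⟩ :
      {a : Fin (m + 3) × Fin (n + 3) →₀ ℕ // Finsupp.weight biweight a = tableWeight m n k}) := by
  constructor
  · intro s t h
    exact table_injective k (padTable_injective (Subtype.ext_iff.mp h))
  · rintro ⟨a, ha⟩
    obtain ⟨s, hs⟩ := exists_padTable_table_eq ha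
    exact ⟨s, Subtype.ext hs⟩

/-- The seven tables enumerate the exponents of weight `tableWeight m n k`. -/
noncomputable def tableEquiv (m n k : ℕ) : Fin 7 ≃
    {a : Fin (m + 3) × Fin (n + 3) →₀ ℕ // Finsupp.weight biweight a = tableWeight m n k} :=
  Equiv.ofBijective _ (bijective_padTable_table k)

theorem mem_contingencyTables_iff_tableWeight {a : Fin 3 × Fin 3 →₀ ℕ} :
    a ∈ contingencyTables ![2, 1, 1] ![1, 2, 1] ↔
      Finsupp.weight biweight a = tableWeight 0 0 0 := by
  rw [mem_contingencyTables, tableWeight]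
  have h1 : ![2, 1, 1] = (pad ![0 + 2, 1, 1] : Fin (0 + 3) → ℕ) := by
    ext i; fin_cases i <;> rfl
  have h2 : ![1, 2, 1] = (pad ![1, 0 + 2, 1] : Fin (0 + 3) → ℕ) := by
    ext i; fin_cases i <;> rfl
  exact iff_of_eq (congrArg _ (Prod.ext h1 h2))

/-- The enumeration of the contingency tables with margins `(2, 1, 1)` and `(1, 2, 1)`. -/
noncomputable def contingencyTablesEquiv :
    Fin 7 ≃ contingencyTables ![2, 1, 1] ![1, 2, 1] :=
  (tableEquiv 0 0 0).trans
    (Equiv.subtypeEquivRight fun _ => mem_contingencyTables_iff_tableWeight.symm)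

theorem weightMatrix_apply (t s : Fin 7) :
    weightMatrix ![2, 1, 1] ![1, 2, 1] (contingencyTablesEquiv t) (contingencyTablesEquiv s) =
      blockMatrix t s :=
  coeff_operator_table 0 t s

theorem charpoly_weightMatrix : (weightMatrix ![2, 1, 1] ![1, 2, 1]).charpoly =
    ((X - 1) * (X + 1) * quintic).map (algebraMap ℚ ℂ) := by
  have h : weightMatrix ![2, 1, 1] ![1, 2, 1] =
      Matrix.reindex contingencyTablesEquiv contingencyTablesEquiv
        (blockMatrix.map (Int.castRingHom ℂ)) := by
    ext a b
    obtain ⟨t, rfl⟩ := contingencyTablesEquiv.surjective a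
    obtain ⟨s, rfl⟩ := contingencyTablesEquiv.surjective b
    simp [weightMatrix_apply]
  rw [h, Matrix.charpoly_reindex, Matrix.charpoly_map, charpoly_blockMatrix]
  simp [quintic]

theorem mem_exponents_of_weight {k : ℕ} {a : Fin (m + 3) × Fin (n + 3) →₀ ℕ}
    (h : Finsupp.weight biweight a = tableWeight m n k) :
    a ∈ exponents (m + 3) (n + 3) (k + 4) := by
  rw [mem_exponents, h, tableWeight, sum_fin_add_three]
  simp [Nat.add_assoc]

/-- The weight `tableWeight m n k` and the weight `(2,1,1), (1,2,1)` are both enumerated by the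
seven tables, with the same matrix `blockMatrix`. The off-diagonal blocks vanish because weights are
preserved. -/
theorem exists_reindex_degreeMatrix (m n k : ℕ) :
    ∃ (l : ℕ) (e : exponents (m + 3) (n + 3) (k + 4) ≃
        contingencyTables ![2, 1, 1] ![1, 2, 1] ⊕ Fin l) (N : Matrix (Fin l) (Fin l) ℂ),
      Matrix.reindex e e (degreeMatrix (m + 3) (n + 3) (k + 4)) =
        Matrix.fromBlocks (weightMatrix ![2, 1, 1] ![1, 2, 1]) 0 0 N := by
  classical
  let p (a : exponents (m + 3) (n + 3) (k + 4)) : Prop :=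
    Finsupp.weight biweight a.1 = tableWeight m n k
  let e₁ : Fin 7 ≃ {a // p a} := (tableEquiv m n k).trans
    { toFun a := ⟨⟨a.1, mem_exponents_of_weight a.2⟩, a.2⟩
      invFun a := ⟨a.1.1, a.2⟩
      left_inv _ := rfl
      right_inv _ := rfl }
  let e := (Equiv.sumCompl p).symm.trans
    (Equiv.sumCongr (e₁.symm.trans contingencyTablesEquiv) (Fintype.equivFin {a // ¬ p a}))
  have hl (s : Fin 7) : (e.symm (.inl (contingencyTablesEquiv s))).1 = padTable (table k s) := by
    have : e.symm (.inl (contingencyTablesEquiv s)) = (e₁ s).1 := by simp [e]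
    rw [this]
    rfl
  have hr (i) : Finsupp.weight biweight (e.symm (.inr i)).1 ≠ tableWeight m n k := by
    have : e.symm (.inr i) = ((Fintype.equivFin {a // ¬ p a}).symm i).1 := by simp [e]
    rw [this]
    exact ((Fintype.equivFin {a // ¬ p a}).symm i).2
  -- The complementary block is left unspecified: only the vanishing off the diagonal matters.
  refine ⟨_, e, (Matrix.reindex e e (degreeMatrix (m + 3) (n + 3) (k + 4))).toBlocks₂₂, ?_⟩
  ext (a | i) (b | j)
  · obtain ⟨t, rfl⟩ := contingencyTablesEquiv.surjective a
    obtain ⟨s, rfl⟩ := contingencyTablesEquiv.surjective b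
    rw [Matrix.fromBlocks_apply₁₁, weightMatrix_apply, ← coeff_operator_table k t s, ← hl, ← hl]
    rfl
  · obtain ⟨t, rfl⟩ := contingencyTablesEquiv.surjective a
    refine coeff_operator_eq_zero fun h => hr j ?_
    rw [← h, hl, weight_padTable_table]
  · obtain ⟨s, rfl⟩ := contingencyTablesEquiv.surjective b
    refine coeff_operator_eq_zero fun h => hr i ?_
    rw [h, hl, weight_padTable_table]
  · rfl

theorem exists_charpoly_degreeMatrix_eq_map (m n k : ℕ) :
    ∃ p : ℤ[X], (degreeMatrix (m + 3) (n + 3) (k + 4)).charpoly = p.map (Int.castRingHom ℂ) ∧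
      ¬ SolvableByRadicals (p.map (Int.castRingHom ℚ)) := by
  obtain ⟨M, hM⟩ := exists_matrixOn_eq_map (exponents (m + 3) (n + 3) (k + 4))
  have hp : (degreeMatrix (m + 3) (n + 3) (k + 4)).charpoly =
      M.charpoly.map (Int.castRingHom ℂ) := by
    rw [degreeMatrix, hM, Matrix.charpoly_map]
  refine ⟨M.charpoly, hp, fun hsol => ?_⟩
  have hcard : 0 < Fintype.card (quintic.rootSet ℂ) := by
    rw [card_rootSet_quintic_complex]; norm_num
  obtain ⟨x, hx⟩ := Fintype.card_pos_iff.mp hcard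
  refine not_mem_solvableByRad_of_quintic hx (hsol x ?_)
  obtain ⟨l, e, N, he⟩ := exists_reindex_degreeMatrix m n k
  rw [mem_rootSet_of_ne ((Matrix.charpoly_monic M).map _).ne_zero, aeval_def, eval₂_eq_eval_map,
    map_map, RingHom.ext_int ((algebraMap ℚ ℂ).comp _) (Int.castRingHom ℂ), ← hp,
    ← Matrix.charpoly_reindex e, he, Matrix.charpoly_fromBlocks_zero₂₁, charpoly_weightMatrix,
    eval_mul, eval_map_algebraMap, map_mul, aeval_eq_zero_of_mem_rootSet hx, mul_zero, zero_mul]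

end Blocks

end RSK

theorem theorem4p7 (m n d : ℕ) (hm : 3 ≤ m) (hn : 3 ≤ n) (hd : 4 ≤ d) :
    -- the characteristic polynomial has integer coefficients and is not solvable by radicals
    (∃ p : ℤ[X], (RSK.degreeMatrix m n d).charpoly = p.map (Int.castRingHom ℂ) ∧
      ¬ RSK.SolvableByRadicals (p.map (Int.castRingHom ℚ))) ∧
    -- after a reordering of the monomials, the weight matrix of (211, 121) is a diagonal block
    (∃ (k : ℕ)
        (e : RSK.exponents m n d ≃ RSK.contingencyTables ![2, 1, 1] ![1, 2, 1] ⊕ Fin k)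
        (N : Matrix (Fin k) (Fin k) ℂ),
      Matrix.reindex e e (RSK.degreeMatrix m n d) =
        Matrix.fromBlocks (RSK.weightMatrix ![2, 1, 1] ![1, 2, 1]) 0 0 N) ∧
    -- the quintic is a factor of the characteristic polynomial of that block
    (RSK.weightMatrix ![2, 1, 1] ![1, 2, 1]).charpoly =
      ((X - 1) * (X + 1) * RSK.quintic).map (algebraMap ℚ ℂ) ∧
    Irreducible RSK.quintic ∧
    (RSK.quintic.rootSet ℝ).ncard = 3 ∧
    Nonempty (RSK.quintic.Gal ≃* Equiv.Perm (Fin 5)) := by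
  obtain ⟨m, rfl⟩ := Nat.exists_eq_add_of_le' hm
  obtain ⟨n, rfl⟩ := Nat.exists_eq_add_of_le' hn
  obtain ⟨k, rfl⟩ := Nat.exists_eq_add_of_le' hd
  exact ⟨RSK.exists_charpoly_degreeMatrix_eq_map m n k, RSK.exists_reindex_degreeMatrix m n k,
    RSK.charpoly_weightMatrix, RSK.irreducible_quintic, RSK.ncard_rootSet_quintic_real,
    RSK.nonempty_gal_quintic_mulEquiv⟩
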